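/- **Setting.** Fix an integer $n\ge 1$, let $\mathcal C_n=\{0,\frac1n,\dots,1\}$, and fix either the Gödel truth functions ($a\otimes b=\min\{a,b\}$, $a\oplus b=\max\{a,b\}$, $a\rhd b=1$ if $a\le b$ and $b$ otherwise) or the Łukasiewicz ones ($a\otimes b=\max\{a+b-1,0\}$, $a\oplus b=\min\{a+b,1\}$, $a\rhd b=\min\{1-a+b,1\}$), in both cases with $\ominus a=1-a$. Concepts are built from concept names, $\top,\bot$ by $\sqcap,\sqcup,\neg$. An interpretation $I$ has a non-empty domain $\Delta$, elements $a^I\in\Delta$ for the individual names $a$, and functions $A^I:\Delta\to\mathcal C_n$ for the concept names $A$, extended to all concepts by $\otimes,\oplus,\ominus$. A typical $C$-element of $I$ is an $x\in\Delta$ with $C^I(x)>0$ such that no $z\in\Delta$ has $C^I(z)>C^I(x)$. Let $\theta\in\{\ge,\le,>,<\}$ and $\alpha\in[0,1]$. $I$ satisfies $E\sqsubseteq F\;\theta\;\alpha$ if $(E^I(x)\rhd F^I(x))\;\theta\;\alpha$ for all $x\in\Delta$; it satisfies $E(a)\;\theta\;\alpha$ if $E^I(a^I)\;\theta\;\alpha$;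 it satisfies $\mathbf T(C)\sqsubseteq D\;\theta\;\alpha$ if $D^I(x)\;\theta\;\alpha$ for every typical $C$-element $x$, and otherwise falsifies it. A weighted knowledge base $K$ consists of a finite set $\mathcal T$ of inclusions $E\sqsubseteq F\;\theta\;\alpha$, a finite set $\mathcal A$ of assertions $E(a)\;\theta\;\alpha$, finitely many distinguished concepts $C_1,\dots,C_m$ and, for each $C_i$, a finite set of typicality inclusions $\mathbf T(C_i)\sqsubseteq D_{i,h}$ with weights $w^i_h\in\mathbb R$. Let $\varphi:\mathbb R\to[0,1]$ be non-decreasing, and let $\varphi_n(x)$ be $0$ if $\varphi(x)\le\frac1{2n}$, $\frac in$ if $\frac{2i-1}{2n}<\varphi(x)\le\frac{2i+1}{2n}$ with $0<i<n$, and $1$ if $\varphi(x)>\frac{2n-1}{2n}$. A $\varphi_n$-coherent model of $K$ is an interpretation that satisfies $\mathcal T$ and $\mathcal A$ and has $C_i^I(x)=\varphi_n\bigl(\sum_h w^i_hD_{i,h}^I(x)\bigr)$ for all $i$ and $x$. It is canonical if for every $\varphi_n$-coherent model $J$ of $K$ and every $y\in\Delta^J$ there is $z\in\Delta$ with $B^I(z)=B^J(y)$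 for all concept names $B$ occurring in $K$. **The program.** Assume that all weights have at most $k$ decimal places, so that $w'=10^kw$ is an integer for every weight $w$. For concepts $C,D$, the program $\Pi(K,n,C,D,\theta,\alpha)$, with integer $v\in\{0,\dots,n\}$ standing for $\frac vn$ and concepts $E$ represented by terms $E'$, has: facts $val(v)$ for $0\le v\le n$; $nom(a)$ for the individual names of $K$; $nom(aux_C)$; $auxtc(aux_C,C')$; $cls(A)$ for the concept names $A$ of $K$, $C$, $D$; $dcls(C_i')$; $subTyp(C_i',D_{i,h}',w'^i_h)$; $concept(E')$ for the concepts $E$ of $K$ and for $C,D$, with rules that propagate $concept$ to subconcepts; the choice rule $1\{inst(X,A,V):val(V)\}1\leftarrow cls(A),nom(X)$; rules that derive $eval(E',X,V)$ from the $inst$ atoms by the truth functions of the chosen logic rescaled to $\{0,\dots,n\}$; a constraint for each assertion $E(a)\,\theta'\,\beta$ in $\mathcal A$, excluding $eval(E',a,V)$ unless $V\,\theta'\,\beta n$, and for each inclusion $E\sqsubseteq F\,\theta'\,\beta$ in $\mathcal T$, excluding $eval(E',X,V_1),eval(F',X,V_2)$ unless the rescaled value of $V_1\rhd V_2$ stands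 in relation $\theta'$ to $\beta n$; for each $i$ a rule deriving $weight(X,C_i',W)$ with $W=\sum_h w'^i_hV_h$ from $nom(X)$ and, for all $h$, $subTyp(C_i',D_{i,h}',w'^i_h)$ and $eval(D_{i,h}',X,V_h)$; rules $num(W)\leftarrow nom(X),weight(X,E,W),dcls(E)$ and $valphi(n,W,V)\leftarrow num(W)$ for $V=n\,\varphi_n\bigl(W/(n10^k)\bigr)$; the constraint $\bot\leftarrow nom(X),dcls(E),eval(E,X,V),weight(X,E,W),valphi(n,W,V_1),V\ne V_1$; and $ok\leftarrow eval(D',aux_C,V),\,V\,\theta\,\alpha n$ and $notok\leftarrow not\ ok$. An answer set $S$ is preferred if there is no answer set $S'$ with $eval(C',aux_C,v')\in S'$, $eval(C',aux_C,v)\in S$ and $v'>v$. **Proposition.** Assume that every concept name occurring in $C$ occurs in $K$, and that, if $K$ has a $\varphi_n$-coherent model at all, then $C^I(x)>0$ for some $\varphi_n$-coherent model $I$ of $K$ and some $x$ in its domain. Then the query $\mathbf T(C)\sqsubseteq D\;\theta\;\alpha$ is falsified in some canonical $\varphi_n$-coherent model of $K$ if and only if there is a preferred answer set $S$ of $\Pi(K,n,C,D,\theta,\alpha)$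 that contains $eval(D',aux_C,v)$ for some $v$ such that $v\;\theta\;\alpha n$ does not hold. Moreover, every such preferred answer set contains $notok$. -/

import Mathlib

universe u v w

namespace MVDL

/-! ### Syntax and many-valued semantics of the boolean description logic -/

/-- The two families of truth functions: Gödel (with involutive negation) and Łukasiewicz. -/
inductive Family
  | godel
  | lukasiewicz

/-- The t-norm `⊗`. -/
noncomputable def Family.tnorm : Family → ℝ → ℝ → ℝ
  | .godel, a, b => min a b
  | .lukasiewicz, a, b => max (a + b - 1) 0

/-- The s-norm `⊕`. -/
noncomputable def Family.snorm : Family → ℝ → ℝ → ℝ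
  | .godel, a, b => max a b
  | .lukasiewicz, a, b => min (a + b) 1

/-- The implication function `▷`. -/
noncomputable def Family.impl : Family → ℝ → ℝ → ℝ
  | .godel, a, b => if a ≤ b then 1 else b
  | .lukasiewicz, a, b => min (1 - a + b) 1

/-- The comparison symbols `θ ∈ {≥, ≤, >, <}`. -/
inductive Cmp
  | ge
  | le
  | gt
  | lt

/-- `θ.Holds a b` is `a θ b`. -/
def Cmp.Holds : Cmp → ℝ → ℝ → Prop
  | .ge, a, b => a ≥ b
  | .le, a, b => a ≤ b
  | .gt, a, b => a > b
  | .lt, a, b => a < b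

/-- Boolean concepts over the concept names `NC`. The same type serves as the type of the ground
terms `and(C', D')`, `or(C', D')`, `neg(C')`, … that represent concepts in a program. -/
inductive BConcept (NC : Type v) : Type v
  | name (A : NC)
  | top
  | bot
  | and (C D : BConcept NC)
  | or (C D : BConcept NC)
  | neg (C : BConcept NC)

/-- The concept names occurring in a concept. -/
def BConcept.names {NC : Type v} : BConcept NC → Set NC
  | .name A => {A}
  | .top => ∅
  | .bot => ∅
  | .and C D => C.names ∪ D.names
  | .or C D => C.names ∪ D.names
  | .neg C => C.names

/-- The truth space `{0, 1/n, …, n/n}`. -/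
def truthSpace (n : ℕ) : Set ℝ := {r | ∃ i : ℕ, i ≤ n ∧ r = (i : ℝ) / n}

/-- A finitely many-valued interpretation over the truth space `{0, 1/n, …, 1}`. -/
structure Interp (NC : Type v) (NI : Type w) (n : ℕ) : Type (max (u + 1) v w) where
  Dom : Type u
  dom_nonempty : Nonempty Dom
  ind : NI → Dom
  conc : NC → Dom → ℝ
  conc_mem : ∀ A x, conc A x ∈ truthSpace n

namespace Interp

variable {NC : Type v} {NI : Type w} {n : ℕ}

/-- The membership degree `C^I(x)`. -/
noncomputable def deg (I : Interp.{u} NC NI n) (L : Family) : BConcept NC → I.Dom → ℝ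
  | .name A, x => I.conc A x
  | .top, _ => 1
  | .bot, _ => 0
  | .and C D, x => L.tnorm (I.deg L C x) (I.deg L D x)
  | .or C D, x => L.snorm (I.deg L C x) (I.deg L D x)
  | .neg C, x => 1 - I.deg L C x

/-- The induced preference `x <_C y`, i.e. `C^I(x) > C^I(y)`. -/
def Pref (I : Interp.{u} NC NI n) (L : Family) (C : BConcept NC) (x y : I.Dom) : Prop :=
  I.deg L C x > I.deg L C y

/-- `x` is a typical `C`-element: a `<_C`-minimal element of `{y | C^I(y) > 0}`. -/
def Typical (I : Interp.{u} NC NI n) (L : Family) (C : BConcept NC) (x : I.Dom) : Prop :=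
  0 < I.deg L C x ∧ ¬ ∃ z : I.Dom, 0 < I.deg L C z ∧ I.Pref L C z x

/-- `I` satisfies the typicality inclusion `T(C) ⊑ D θ α`: every typical `C`-element is an
instance of `D` with a degree `d` such that `d θ α`. -/
def SatTypIncl (I : Interp.{u} NC NI n) (L : Family) (C D : BConcept NC) (θ : Cmp) (α : ℝ) :
    Prop :=
  ∀ x : I.Dom, I.Typical L C x → θ.Holds (I.deg L D x) α

end Interp

/-! ### Weighted knowledge bases -/

/-- A strict inclusion axiom `lhs ⊑ rhs θ α`, with `α ∈ [0,1]`. -/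
structure Incl (NC : Type v) : Type v where
  lhs : BConcept NC
  rhs : BConcept NC
  cmp : Cmp
  bound : Set.Icc (0 : ℝ) 1

/-- An assertion `C(a) θ α`, with `α ∈ [0,1]`. -/
structure Assertion (NC : Type v) (NI : Type w) : Type (max v w) where
  conc : BConcept NC
  ind : NI
  cmp : Cmp
  bound : Set.Icc (0 : ℝ) 1

/-- A weighted knowledge base: a TBox, an ABox, the set `dist` of distinguished concepts, and for
each distinguished concept `C` the finite set `typ C` of the pairs `(D, w)` such that
`T(C) ⊑ D` is a typicality inclusion with weight `w`. (`typ C` is never used for `C ∉ dist`.) -/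
structure KB (NC : Type v) (NI : Type w) : Type (max v w) where
  tbox : Finset (Incl NC)
  abox : Finset (Assertion NC NI)
  dist : Finset (BConcept NC)
  typ : BConcept NC → Finset (BConcept NC × ℝ)

namespace KB

variable {NC : Type v} {NI : Type w}

/-- The concepts that occur (not as proper subconcepts) in the knowledge base. -/
def concepts (K : KB NC NI) : Set (BConcept NC) :=
  {E | (∃ i ∈ K.tbox, E = i.lhs ∨ E = i.rhs) ∨ (∃ a ∈ K.abox, E = a.conc) ∨ E ∈ K.dist ∨
    ∃ C ∈ K.dist, ∃ p ∈ K.typ C, E = p.1}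

/-- The concept names occurring in the knowledge base. -/
def names (K : KB NC NI) : Set NC := {A | ∃ E ∈ K.concepts, A ∈ E.names}

/-- The individual names occurring in the knowledge base. -/
def inds (K : KB NC NI) : Set NI := {a | ∃ s ∈ K.abox, s.ind = a}

/-- The weights of the typicality inclusions are decimal numbers with `k` decimal places. -/
def HasDecimalWeights (K : KB NC NI) (k : ℕ) : Prop :=
  ∀ C ∈ K.dist, ∀ p ∈ K.typ C, ∃ z : ℤ, p.2 * 10 ^ k = z

end KB

namespace Interp

variable {NC : Type v} {NI : Type w} {n : ℕ}

/-- `I` satisfies a strict inclusion `E ⊑ D θ α`: `E^I(x) ▷ D^I(x) θ α` for all `x`. For `≥` and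
`>` this is the same as comparing `inf_x (E^I(x) ▷ D^I(x))` with `α`, since the infimum over the
finite truth space is attained. -/
def SatIncl (I : Interp.{u} NC NI n) (L : Family) (i : Incl NC) : Prop :=
  ∀ x : I.Dom, i.cmp.Holds (L.impl (I.deg L i.lhs x) (I.deg L i.rhs x)) i.bound

/-- `I` satisfies an assertion `C(a) θ α`. -/
def SatAssertion (I : Interp.{u} NC NI n) (L : Family) (s : Assertion NC NI) : Prop :=
  s.cmp.Holds (I.deg L s.conc (I.ind s.ind)) s.bound

/-- `f`-coherence: `C^I(x) = f (∑_h w_h D_h^I(x))` for every distinguished `C` and every `x`. -/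
def Coherent (I : Interp.{u} NC NI n) (L : Family) (f : ℝ → ℝ) (K : KB NC NI) : Prop :=
  ∀ C ∈ K.dist, ∀ x : I.Dom, I.deg L C x = f (∑ p ∈ K.typ C, p.2 * I.deg L p.1 x)

/-- `I` is an `f`-coherent model of `K`. -/
def IsModel (I : Interp.{u} NC NI n) (L : Family) (f : ℝ → ℝ) (K : KB NC NI) : Prop :=
  (∀ i ∈ K.tbox, I.SatIncl L i) ∧ (∀ s ∈ K.abox, I.SatAssertion L s) ∧ I.Coherent L f K

/-- `I` is a canonical `f`-coherent model of `K`. -/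
def IsCanonical (I : Interp.{u} NC NI n) (L : Family) (f : ℝ → ℝ) (K : KB NC NI) : Prop :=
  I.IsModel L f K ∧
    ∀ J : Interp.{u} NC NI n, J.IsModel L f K → ∀ y : J.Dom,
      ∃ z : I.Dom, ∀ B ∈ K.names, I.conc B z = J.conc B y

end Interp

/-- The approximation `φ_n` of `φ` over `{0, 1/n, …, 1}`. In the middle case `⌈n φ(x) - 1/2⌉` is
the integer `i` with `(2i - 1)/(2n) < φ(x) ≤ (2i + 1)/(2n)`, see `phiN_eq`. -/
noncomputable def phiN (φ : ℝ → ℝ) (n : ℕ) (x : ℝ) : ℝ :=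
  if φ x ≤ 1 / (2 * n) then 0
  else if (2 * n - 1) / (2 * n) < φ x then 1
  else (⌈(n : ℝ) * φ x - 1 / 2⌉ : ℝ) / n

theorem phiN_eq (φ : ℝ → ℝ) (n : ℕ) (x : ℝ) (i : ℕ) (hi : 0 < i) (hin : i < n)
    (h1 : (2 * (i : ℝ) - 1) / (2 * n) < φ x) (h2 : φ x ≤ (2 * (i : ℝ) + 1) / (2 * n)) :
    phiN φ n x = i / n := by
  have hn : (0 : ℝ) < 2 * n := by
    have : 0 < n := by omega
    positivity
  have hi' : (1 : ℝ) ≤ i := by exact_mod_cast hi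
  have hin' : (i : ℝ) + 1 ≤ n := by exact_mod_cast hin
  rw [div_lt_iff₀ hn] at h1
  rw [le_div_iff₀ hn] at h2
  have e1 : ¬ φ x ≤ 1 / (2 * n) := by
    rw [le_div_iff₀ hn]; linarith
  have e2 : ¬ (2 * (n : ℝ) - 1) / (2 * n) < φ x := by
    rw [div_lt_iff₀ hn]; linarith
  have e3 : ⌈(n : ℝ) * φ x - 1 / 2⌉ = (i : ℤ) := by
    rw [Int.ceil_eq_iff]
    push_cast
    constructor <;> linarith
  rw [phiN, if_neg e1, if_neg e2, e3]
  simp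

/-! ### Answer sets of ground programs -/

/-- Rule heads: an atom, the empty head `⊥` of a constraint, or `1{s}1`. -/
inductive Head (α : Type u) : Type u
  | atom (a : α)
  | falsum
  | exactlyOne (s : Set α)

/-- A ground rule `head ← pos, not neg`. -/
structure GRule (α : Type u) : Type u where
  head : Head α
  pos : Set α
  neg : Set α

/-- The head is satisfied by the set `S` of atoms. -/
def Head.Sat {α : Type u} (S : Set α) : Head α → Prop
  | .atom a => a ∈ S
  | .falsum => False
  | .exactlyOne s => ∃! a, a ∈ s ∧ a ∈ S

/-- `S` satisfies the rule `r`. -/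
def GRule.Sat {α : Type u} (S : Set α) (r : GRule α) : Prop :=
  r.pos ⊆ S → Disjoint r.neg S → r.head.Sat S

/-- The atoms that a head supports relative to `S`: for a choice head, its elements that are
in `S`. -/
def Head.supported {α : Type u} (S : Set α) : Head α → Set α
  | .atom a => {a}
  | .falsum => ∅
  | .exactlyOne s => s ∩ S

/-- `M` is closed under the reduct of `P` relative to `S`, i.e. under the definite rules
`a ← r.pos`, for the rules `r` of `P` whose negative body holds in `S` and the atoms `a` supported
by the head of `r`. -/
def ReductClosed {α : Type u} (P : Set (GRule α)) (S M : Set α) : Prop :=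
  ∀ r ∈ P, Disjoint r.neg S → r.pos ⊆ M → r.head.supported S ⊆ M

/-- `S` is an answer set (stable model) of `P`: it satisfies all the rules of `P` and is the least
model of the reduct of `P` relative to `S`. -/
def IsAnswerSet {α : Type u} (P : Set (GRule α)) (S : Set α) : Prop :=
  (∀ r ∈ P, r.Sat S) ∧ S = ⋂₀ {M | ReductClosed P S M}

/-! ### The encoding -/

/-- The constants that denote domain elements: individual names and `aux_C`. -/
inductive Const (NI : Type w) : Type w
  | ind (a : NI)
  | aux

/-- The ground atoms of the encoding. -/
inductive Atom (NC : Type v) (NI : Type w) : Type (max v w)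
  | val (i : ℤ)
  | nom (x : Const NI)
  | cls (A : NC)
  | concept (E : BConcept NC)
  | dcls (C : BConcept NC)
  | subTyp (C D : BConcept NC) (w : ℤ)
  | inst (x : Const NI) (A : NC) (i : ℤ)
  | eval (E : BConcept NC) (x : Const NI) (i : ℤ)
  | weight (x : Const NI) (C : BConcept NC) (w : ℤ)
  | num (w : ℤ)
  | valphi (w i : ℤ)
  | auxtc (x : Const NI) (C : BConcept NC)
  | ok
  | notok

/-- The t-norm on `{0, …, n}`, with `i` standing for `i / n`. -/
def Family.tnormZ (n : ℤ) : Family → ℤ → ℤ → ℤ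
  | .godel, a, b => min a b
  | .lukasiewicz, a, b => max (a + b - n) 0

/-- The s-norm on `{0, …, n}`. -/
def Family.snormZ (n : ℤ) : Family → ℤ → ℤ → ℤ
  | .godel, a, b => max a b
  | .lukasiewicz, a, b => min (a + b) n

/-- The implication function on `{0, …, n}`. -/
def Family.implZ (n : ℤ) : Family → ℤ → ℤ → ℤ
  | .godel, a, b => if a ≤ b then n else b
  | .lukasiewicz, a, b => min (n - a + b) n

/-- The integer that represents a weight `w` up to `k` decimal places. -/
noncomputable def weightInt (k : ℕ) (w : ℝ) : ℤ := round (w * 10 ^ k)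

/-- A fact. -/
def GRule.fact {α : Type u} (a : α) : GRule α := ⟨.atom a, ∅, ∅⟩

/-- A definite rule. -/
def GRule.rule {α : Type u} (a : α) (B : Set α) : GRule α := ⟨.atom a, B, ∅⟩

/-- A constraint. -/
def GRule.constraint {α : Type u} (B : Set α) : GRule α := ⟨.falsum, B, ∅⟩

section Encoding

variable {NC : Type v} {NI : Type w}

open Atom GRule

/-- The ground instances of the rules of the program `Π(K, n, C, D, θ, α)`; `k` is the number of
decimal places of the weights. Arithmetic and comparisons are evaluated when grounding. -/
inductive EncRule (L : Family) (φ : ℝ → ℝ) (n k : ℕ) (K : KB NC NI) (C D : BConcept NC)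
    (θ : Cmp) (α : ℝ) : GRule (Atom NC NI) → Prop
  -- facts describing the knowledge base and the query
  | val (i : ℤ) (h0 : 0 ≤ i) (hn : i ≤ n) : EncRule L φ n k K C D θ α (fact (val i))
  | nom (a : NI) (ha : a ∈ K.inds) : EncRule L φ n k K C D θ α (fact (nom (.ind a)))
  | nomAux : EncRule L φ n k K C D θ α (fact (nom .aux))
  | auxtc : EncRule L φ n k K C D θ α (fact (auxtc .aux C))
  | cls (A : NC) (hA : A ∈ K.names ∪ C.names ∪ D.names) :
      EncRule L φ n k K C D θ α (fact (cls A))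
  | dcls (E : BConcept NC) (hE : E ∈ K.dist) : EncRule L φ n k K C D θ α (fact (dcls E))
  | subTyp (E : BConcept NC) (hE : E ∈ K.dist) (p : BConcept NC × ℝ) (hp : p ∈ K.typ E) :
      EncRule L φ n k K C D θ α (fact (subTyp E p.1 (weightInt k p.2)))
  -- concepts of interest
  | concept (E : BConcept NC) (hE : E ∈ K.concepts ∨ E = C ∨ E = D) :
      EncRule L φ n k K C D θ α (fact (concept E))
  | conceptAndL (E F : BConcept NC) :
      EncRule L φ n k K C D θ α (rule (concept E) {concept (.and E F)})
  | conceptAndR (E F : BConcept NC) :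
      EncRule L φ n k K C D θ α (rule (concept F) {concept (.and E F)})
  | conceptOrL (E F : BConcept NC) :
      EncRule L φ n k K C D θ α (rule (concept E) {concept (.or E F)})
  | conceptOrR (E F : BConcept NC) :
      EncRule L φ n k K C D θ α (rule (concept F) {concept (.or E F)})
  | conceptNeg (E : BConcept NC) :
      EncRule L φ n k K C D θ α (rule (concept E) {concept (.neg E)})
  -- `1{inst(X,A,V) : val(V)}1 ← cls(A), nom(X)`
  | choice (A : NC) (x : Const NI) :
      EncRule L φ n k K C D θ α
        ⟨.exactlyOne {a | ∃ i : ℤ, 0 ≤ i ∧ i ≤ n ∧ a = inst x A i}, {cls A, nom x}, ∅⟩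
  -- evaluation of concepts
  | evalName (A : NC) (x : Const NI) (i : ℤ) :
      EncRule L φ n k K C D θ α (rule (eval (.name A) x i) {cls A, inst x A i})
  | evalTop (x : Const NI) :
      EncRule L φ n k K C D θ α (rule (eval .top x n) {concept .top, nom x})
  | evalBot (x : Const NI) :
      EncRule L φ n k K C D θ α (rule (eval .bot x 0) {concept .bot, nom x})
  | evalAnd (E F : BConcept NC) (x : Const NI) (i j : ℤ) :
      EncRule L φ n k K C D θ α
        (rule (eval (.and E F) x (L.tnormZ n i j)) {concept (.and E F), eval E x i, eval F x j})
  | evalOr (E F : BConcept NC) (x : Const NI) (i j : ℤ) :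
      EncRule L φ n k K C D θ α
        (rule (eval (.or E F) x (L.snormZ n i j)) {concept (.or E F), eval E x i, eval F x j})
  | evalNeg (E : BConcept NC) (x : Const NI) (i : ℤ) :
      EncRule L φ n k K C D θ α (rule (eval (.neg E) x (n - i)) {concept (.neg E), eval E x i})
  -- constraints for the assertions and the strict inclusions
  | abox (s : Assertion NC NI) (hs : s ∈ K.abox) (i : ℤ)
      (h : ¬ s.cmp.Holds (i : ℝ) (s.bound * n)) :
      EncRule L φ n k K C D θ α (constraint {eval s.conc (.ind s.ind) i})
  | tbox (t : Incl NC) (ht : t ∈ K.tbox) (x : Const NI) (i j : ℤ)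
      (h : ¬ t.cmp.Holds (L.implZ n i j : ℝ) (t.bound * n)) :
      EncRule L φ n k K C D θ α (constraint {eval t.lhs x i, eval t.rhs x j})
  -- weighted sums, one rule for each distinguished concept
  | weight (E : BConcept NC) (hE : E ∈ K.dist) (x : Const NI) (V : BConcept NC × ℝ → ℤ) :
      EncRule L φ n k K C D θ α
        (rule (weight x E (∑ p ∈ K.typ E, weightInt k p.2 * V p))
          ({nom x} ∪ {a | ∃ p ∈ K.typ E, a = subTyp E p.1 (weightInt k p.2) ∨
            a = eval p.1 x (V p)}))
  | num (x : Const NI) (E : BConcept NC) (W : ℤ) :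
      EncRule L φ n k K C D θ α (rule (num W) {nom x, weight x E W, dcls E})
  -- `valphi(n,W,V)` for `V = n * φ_n(W / (n * 10^k))`
  | valphi (W i : ℤ) (h : (i : ℝ) = n * phiN φ n ((W : ℝ) / (n * 10 ^ k))) :
      EncRule L φ n k K C D θ α (rule (valphi W i) {num W})
  -- coherence
  | coherence (x : Const NI) (E : BConcept NC) (i j W : ℤ) (h : i ≠ j) :
      EncRule L φ n k K C D θ α
        (constraint {nom x, dcls E, eval E x i, weight x E W, valphi W j})
  -- the query
  | ok (i : ℤ) (h : θ.Holds (i : ℝ) (α * n)) :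
      EncRule L φ n k K C D θ α (rule ok {eval D .aux i})
  | notok : EncRule L φ n k K C D θ α ⟨.atom notok, ∅, {ok}⟩

/-- The program `Π(K, n, C, D, θ, α)`, grounded. -/
def encoding (L : Family) (φ : ℝ → ℝ) (n k : ℕ) (K : KB NC NI) (C D : BConcept NC)
    (θ : Cmp) (α : ℝ) : Set (GRule (Atom NC NI)) :=
  {r | EncRule L φ n k K C D θ α r}

/-- The concept-wise preference: `S` is better than `S'` if the membership degree of `aux_C` in
the concept `E` with `auxtc(aux_C, E)` is higher in `S` than in `S'`. -/
def Better (S S' : Set (Atom NC NI)) : Prop :=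
  ∃ E : BConcept NC, auxtc .aux E ∈ S ∧
    ∃ i j : ℤ, eval E .aux i ∈ S ∧ eval E .aux j ∈ S' ∧ i > j

/-- A preferred answer set: an answer set such that no answer set is better. -/
def IsPreferred (P : Set (GRule (Atom NC NI))) (S : Set (Atom NC NI)) : Prop :=
  IsAnswerSet P S ∧ ¬ ∃ S', IsAnswerSet P S' ∧ Better S' S

end Encoding

end MVDL

/-!
The strict inclusions and the coherence condition constrain each element of an interpretation
separately, and only through the degrees of the concept names at that element. So a canonical model
realizes all tuples of degrees that are admissible in this sense, and its typical `C`-elements are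
those whose tuple has the greatest value of `C`, provided that this value is positive.

An answer set is determined by the tuples that the choice rule guesses for the individual names of
`K` and for `aux_C`, and the constraints say that these tuples are admissible and satisfy the
assertions. As no assertion mentions `aux_C`, the admissible guesses for `aux_C` are again all
admissible tuples, and a preferred answer set is one that maximizes `C` over them.
-/

namespace MVDL

variable {NC : Type v} {NI : Type w} {n k : ℕ} {L : Family} {f : ℝ → ℝ}

/-! ### Values of concepts -/

theorem finite_truthSpace (n : ℕ) : (truthSpace n).Finite := by
  refine ((Set.finite_Iic n).image fun i : ℕ => (i : ℝ) / n).subset ?_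
  rintro _ ⟨i, hi, rfl⟩
  exact ⟨i, hi, rfl⟩

instance : Finite (truthSpace n) := (finite_truthSpace n).to_subtype

instance : Nonempty (truthSpace n) := ⟨0, 0, n.zero_le, by simp⟩

theorem mem_truthSpace_iff [NeZero n] {r : ℝ} :
    r ∈ truthSpace n ↔ ∃ i : ℤ, 0 ≤ i ∧ i ≤ n ∧ (i : ℝ) = r * n := by
  have hn : (n : ℝ) ≠ 0 := NeZero.ne _
  constructor
  · rintro ⟨i, hi, rfl⟩
    exact ⟨i, Int.natCast_nonneg i, Int.ofNat_le.2 hi, by simp [hn]⟩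
  · rintro ⟨i, h0, hi, hr⟩
    lift i to ℕ using h0
    exact ⟨i, Int.ofNat_le.1 hi, (eq_div_iff hn).2 (by simpa using hr.symm)⟩

/-- A degree for every concept name: all that an interpretation says about one of its elements. -/
abbrev Assignment (NC : Type v) (n : ℕ) : Type v := NC → truthSpace n

/-- The value of a concept under an assignment, which is its degree at the elements that have this
assignment, see `Interp.deg_eq_value`. It makes elements of different interpretations
comparable. -/
noncomputable def BConcept.value (L : Family) (c : Assignment NC n) : BConcept NC → ℝ
  | .name A => c A
  | .top => 1
  | .bot => 0
  | .and E F => L.tnorm (E.value L c) (F.value L c)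
  | .or E F => L.snorm (E.value L c) (F.value L c)
  | .neg E => 1 - E.value L c

theorem BConcept.value_congr {c c' : Assignment NC n} {E : BConcept NC}
    (h : Set.EqOn c c' E.names) : E.value L c = E.value L c' := by
  induction E with
  | name A => exact congrArg Subtype.val (h rfl)
  | top | bot => rfl
  | and E F ihE ihF | or E F ihE ihF =>
    simp only [value, ihE fun _ hA => h (Or.inl hA), ihF fun _ hA => h (Or.inr hA)]
  | neg E ih => simp only [value, ih h]

theorem Family.cast_tnormZ (L : Family) {a b : ℝ} {i j : ℤ} (hi : (i : ℝ) = a * n)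
    (hj : (j : ℝ) = b * n) : (L.tnormZ n i j : ℝ) = L.tnorm a b * n := by
  have hn : (0 : ℝ) ≤ n := n.cast_nonneg
  cases L with
  | godel => simp only [tnormZ, tnorm, Int.cast_min, hi, hj, min_mul_of_nonneg _ _ hn]
  | lukasiewicz =>
    simp only [tnormZ, tnorm, max_mul_of_nonneg _ _ hn]
    push_cast [hi, hj]
    ring_nf

theorem Family.cast_snormZ (L : Family) {a b : ℝ} {i j : ℤ} (hi : (i : ℝ) = a * n)
    (hj : (j : ℝ) = b * n) : (L.snormZ n i j : ℝ) = L.snorm a b * n := by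
  have hn : (0 : ℝ) ≤ n := n.cast_nonneg
  cases L with
  | godel => simp only [snormZ, snorm, Int.cast_max, hi, hj, max_mul_of_nonneg _ _ hn]
  | lukasiewicz =>
    simp only [snormZ, snorm, min_mul_of_nonneg _ _ hn]
    push_cast [hi, hj]
    ring_nf

theorem Family.cast_implZ [NeZero n] (L : Family) {a b : ℝ} {i j : ℤ} (hi : (i : ℝ) = a * n)
    (hj : (j : ℝ) = b * n) : (L.implZ n i j : ℝ) = L.impl a b * n := by
  have hn : (0 : ℝ) < n := Nat.cast_pos.2 (NeZero.pos n)
  cases L with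
  | godel =>
    have hle : i ≤ j ↔ a ≤ b := by
      rw [← Int.cast_le (R := ℝ), hi, hj, mul_le_mul_iff_left₀ hn]
    simp only [implZ, impl, hle]
    split_ifs <;> simp [hj]
  | lukasiewicz =>
    simp only [implZ, impl, min_mul_of_nonneg _ _ hn.le]
    push_cast [hi, hj]
    ring_nf

theorem Cmp.holds_mul_right_iff (θ : Cmp) {a b c : ℝ} (hc : 0 < c) :
    θ.Holds (a * c) (b * c) ↔ θ.Holds a b := by
  cases θ with
  | ge | le => exact mul_le_mul_iff_left₀ hc
  | gt | lt => exact mul_lt_mul_iff_left₀ hc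

theorem BConcept.exists_int_eq_value_mul [NeZero n] (L : Family) (c : Assignment NC n)
    (E : BConcept NC) : ∃ i : ℤ, (i : ℝ) = E.value L c * n := by
  induction E with
  | name A =>
    obtain ⟨i, -, -, hi⟩ := mem_truthSpace_iff.1 (c A).2
    exact ⟨i, hi⟩
  | top => exact ⟨n, by simp [value]⟩
  | bot => exact ⟨0, by simp [value]⟩
  | and E F ihE ihF =>
    obtain ⟨i, hi⟩ := ihE
    obtain ⟨j, hj⟩ := ihF
    exact ⟨_, L.cast_tnormZ hi hj⟩
  | or E F ihE ihF =>
    obtain ⟨i, hi⟩ := ihE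
    obtain ⟨j, hj⟩ := ihF
    exact ⟨_, L.cast_snormZ hi hj⟩
  | neg E ih =>
    obtain ⟨i, hi⟩ := ih
    exact ⟨n - i, by push_cast [hi, value]; ring⟩

theorem exists_int_eq_phiN_mul [NeZero n] (φ : ℝ → ℝ) (x : ℝ) :
    ∃ i : ℤ, (i : ℝ) = phiN φ n x * n := by
  have hn : (n : ℝ) ≠ 0 := NeZero.ne _
  unfold phiN
  split_ifs
  · exact ⟨0, by simp⟩
  · exact ⟨n, by simp⟩
  · exact ⟨_, (div_mul_cancel₀ _ hn).symm⟩

/-! ### Admissible assignments -/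

/-- The argument of the activation function in the coherence condition for the distinguished concept
`E`, at an element with assignment `c`. -/
noncomputable def KB.weightedSum (K : KB NC NI) (L : Family) (c : Assignment NC n)
    (E : BConcept NC) : ℝ :=
  ∑ p ∈ K.typ E, p.2 * p.1.value L c

/-- The part of being an `f`-coherent model that concerns a single element, in terms of the
assignment of that element. -/
structure KB.Admits (K : KB NC NI) (L : Family) (f : ℝ → ℝ) (c : Assignment NC n) : Prop where
  incl : ∀ t ∈ K.tbox, t.cmp.Holds (L.impl (t.lhs.value L c) (t.rhs.value L c)) t.bound
  coherent : ∀ E ∈ K.dist, E.value L c = f (K.weightedSum L c E)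

/-- The constants `x` of the program with a fact `nom(x)`: the individual names of `K` and
`aux_C`. -/
def KB.IsNom (K : KB NC NI) : Const NI → Prop
  | .ind a => a ∈ K.inds
  | .aux => True

/-- Assignments for the constants of the program under which these constants could denote elements
of an `f`-coherent model of `K`. The assignments of individual names that do not occur in `K` are
irrelevant. -/
structure KB.IsAdmissible (K : KB NC NI) (L : Family) (f : ℝ → ℝ)
    (v : Const NI → Assignment NC n) : Prop where
  admits : ∀ x, K.IsNom x → K.Admits L f (v x)
  assertion : ∀ s ∈ K.abox, s.cmp.Holds (s.conc.value L (v (.ind s.ind))) s.bound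

/-- Admissible assignments with the greatest possible degree of `aux_C` in `C`; they correspond both
to typical `C`-elements of canonical models and to preferred answer sets. -/
structure KB.IsOptimal (K : KB NC NI) (L : Family) (f : ℝ → ℝ) (C : BConcept NC)
    (v : Const NI → Assignment NC n) : Prop where
  isAdmissible : K.IsAdmissible L f v
  value_le : ∀ v' : Const NI → Assignment NC n, K.IsAdmissible L f v' →
    C.value L (v' .aux) ≤ C.value L (v .aux)

namespace Interp

variable {I : Interp.{u} NC NI n} {K : KB NC NI}

/-- The assignment of the element `x`. -/
def assignment (I : Interp.{u} NC NI n) (x : I.Dom) : Assignment NC n :=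
  fun A => ⟨I.conc A x, I.conc_mem A x⟩

theorem deg_eq_value (E : BConcept NC) (x : I.Dom) :
    I.deg L E x = E.value L (I.assignment x) := by
  induction E with
  | name | top | bot => rfl
  | and E F ihE ihF | or E F ihE ihF => simp only [deg, BConcept.value, ihE, ihF]
  | neg E ih => simp only [deg, BConcept.value, ih]

theorem isModel_iff : I.IsModel L f K ↔
    (∀ x, K.Admits L f (I.assignment x)) ∧ ∀ s ∈ K.abox, I.SatAssertion L s := by
  simp only [IsModel, SatIncl, Coherent, deg_eq_value]
  exact ⟨fun ⟨ht, ha, hc⟩ => ⟨fun x => ⟨fun t h => ht t h x, fun E h => hc E h x⟩, ha⟩,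
    fun ⟨h, ha⟩ => ⟨fun t ht x => (h x).incl t ht, ha, fun E hE x => (h x).coherent E hE⟩⟩

/-- The assignments of the constants if `aux_C` denotes the element `x`. -/
def constAssignment (I : Interp.{u} NC NI n) (x : I.Dom) : Const NI → Assignment NC n
  | .ind a => I.assignment (I.ind a)
  | .aux => I.assignment x

theorem IsModel.isAdmissible (hI : I.IsModel L f K) (x : I.Dom) :
    K.IsAdmissible L f (I.constAssignment x) := by
  obtain ⟨hadm, habox⟩ := isModel_iff.1 hI
  refine ⟨fun y _ => ?_, fun s hs => ?_⟩
  · cases y <;> exact hadm _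
  · rw [constAssignment, ← deg_eq_value]
    exact habox s hs

theorem typical_iff {C : BConcept NC} {x : I.Dom} :
    I.Typical L C x ↔ 0 < I.deg L C x ∧ ∀ z, I.deg L C z ≤ I.deg L C x := by
  refine and_congr_right fun hx => ?_
  rw [not_exists]
  exact forall_congr' fun z =>
    ⟨fun h => not_lt.1 fun hlt => h ⟨hx.trans hlt, hlt⟩, fun h hz => h.not_gt hz.2⟩

end Interp

/-! ### Canonical models -/

theorem BConcept.finite_names (E : BConcept NC) : E.names.Finite := by
  induction E with
  | name A => exact Set.finite_singleton A
  | top | bot => exact Set.finite_empty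
  | and E F ihE ihF | or E F ihE ihF => exact ihE.union ihF
  | neg _ ih => exact ih

theorem KB.finite_concepts (K : KB NC NI) : K.concepts.Finite := by
  refine (((K.tbox.finite_toSet.biUnion fun i _ => Set.toFinite {i.lhs, i.rhs}).union
    (K.abox.finite_toSet.image Assertion.conc)).union (K.dist.finite_toSet.union
    (K.dist.finite_toSet.biUnion fun E _ => (K.typ E).finite_toSet.image Prod.fst))).subset ?_
  rintro E (⟨i, hi, h⟩ | ⟨a, ha, rfl⟩ | h | ⟨F, hF, p, hp, rfl⟩)
  · exact Or.inl (Or.inl (Set.mem_biUnion hi h))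
  · exact Or.inl (Or.inr ⟨a, ha, rfl⟩)
  · exact Or.inr (Or.inl h)
  · exact Or.inr (Or.inr (Set.mem_biUnion hF ⟨p, hp, rfl⟩))

theorem KB.finite_names (K : KB NC NI) : K.names.Finite := by
  refine (K.finite_concepts.biUnion fun E _ => E.finite_names).subset ?_
  rintro A ⟨E, hE, hA⟩
  exact Set.mem_biUnion hE hA

/-- As the universe of `X` is arbitrary, `X` can be the domain of an `Interp.{u}`. -/
theorem exists_representatives_eqOn {β γ : Type*} [Finite γ] (V : Set (β → γ)) {R : Set β}
    (hR : R.Finite) : ∃ (X : Type u) (rep : X → β → γ), (∀ x, rep x ∈ V) ∧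
      ∀ g ∈ V, ∃ x, Set.EqOn (rep x) g R := by
  have := hR.to_subtype
  let ρ : V → R → γ := fun g => R.domRestrict g.1
  have : Small.{u} (Set.range ρ) := Countable.toSmall _
  refine ⟨Shrink.{u} (Set.range ρ),
    fun x => (Set.rangeSplitting ρ ((equivShrink _).symm x)).1, fun x => Subtype.coe_prop _,
    fun g hg => ⟨equivShrink _ ⟨ρ ⟨g, hg⟩, Set.mem_range_self _⟩, ?_⟩⟩
  simp only [Equiv.symm_apply_apply, ← Set.domRestrict_eq_domRestrict_iff]
  exact Set.apply_rangeSplitting ρ _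

theorem KB.IsAdmissible.exists_isCanonical {K : KB NC NI} {v : Const NI → Assignment NC n}
    (hv : K.IsAdmissible L f v) {R : Set NC} (hR : R.Finite) :
    ∃ I : Interp.{u} NC NI n, I.IsCanonical L f K ∧
      ∃ x : I.Dom, Set.EqOn (I.assignment x) (v .aux) R := by
  obtain ⟨X, rep, hrep, hsurj⟩ := exists_representatives_eqOn.{u}
    {c : Assignment NC n | K.Admits L f c} (K.finite_names.union hR)
  obtain ⟨x₀, hx₀⟩ := hsurj (v .aux) (hv.admits .aux trivial)
  have : Nonempty X := ⟨x₀⟩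
  choose! den hden using fun x hx => hsurj (v x) (hv.admits x hx)
  let I : Interp.{u} NC NI n :=
    ⟨X, this, fun a => den (.ind a), fun A x => rep x A, fun A x => (rep x A).2⟩
  have hI : I.IsModel L f K := by
    refine Interp.isModel_iff.2 ⟨hrep, fun s hs => ?_⟩
    have hconc : s.conc.value L (rep (den (.ind s.ind))) = s.conc.value L (v (.ind s.ind)) :=
      BConcept.value_congr fun A hA =>
        hden (.ind s.ind) ⟨s, hs, rfl⟩ (Or.inl ⟨s.conc, Or.inr (Or.inl ⟨s, hs, rfl⟩), hA⟩)
    rw [Interp.SatAssertion, Interp.deg_eq_value]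
    exact hconc ▸ hv.assertion s hs
  refine ⟨I, ⟨hI, fun J hJ y => ?_⟩, x₀, hx₀.mono Set.subset_union_right⟩
  obtain ⟨z, hz⟩ := hsurj (J.assignment y) ((Interp.isModel_iff.1 hJ).1 y)
  exact ⟨z, fun B hB => congrArg Subtype.val (hz (Or.inl hB))⟩

theorem exists_isCanonical_not_satTypIncl_iff {K : KB NC NI} {C D : BConcept NC} {θ : Cmp} {α : ℝ}
    (hC : C.names ⊆ K.names) :
    (∃ I : Interp.{u} NC NI n, I.IsCanonical L f K ∧ ¬ I.SatTypIncl L C D θ α) ↔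
      ∃ v : Const NI → Assignment NC n, K.IsOptimal L f C v ∧ 0 < C.value L (v .aux) ∧
        ¬ θ.Holds (D.value L (v .aux)) α := by
  simp only [Interp.SatTypIncl, Interp.typical_iff, Interp.deg_eq_value, not_forall]
  constructor
  · rintro ⟨I, ⟨hI, hcan⟩, x, ⟨hpos, hmax⟩, hD⟩
    refine ⟨I.constAssignment x, ⟨hI.isAdmissible x, fun v' hv' => ?_⟩, hpos, hD⟩
    obtain ⟨J, hJ, y, hy⟩ := hv'.exists_isCanonical.{u} C.finite_names
    obtain ⟨z, hz⟩ := hcan J hJ.1 y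
    have hzC : C.value L (I.assignment z) = C.value L (v' .aux) :=
      BConcept.value_congr fun A hA => (Subtype.ext (hz A (hC hA))).trans (hy hA)
    exact hzC ▸ hmax z
  · rintro ⟨v, hv, hpos, hD⟩
    obtain ⟨I, hI, x, hx⟩ :=
      hv.isAdmissible.exists_isCanonical.{u} (C.finite_names.union D.finite_names)
    have hxC : C.value L (I.assignment x) = C.value L (v .aux) :=
      BConcept.value_congr (hx.mono Set.subset_union_left)
    have hxD : D.value L (I.assignment x) = D.value L (v .aux) :=
      BConcept.value_congr (hx.mono Set.subset_union_right)
    refine ⟨I, hI, x, ⟨hxC ▸ hpos, fun z => ?_⟩, hxD ▸ hD⟩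
    exact hxC ▸ hv.value_le _ (hI.1.isAdmissible z)

theorem KB.IsOptimal.value_pos {K : KB NC NI} {C : BConcept NC} {v : Const NI → Assignment NC n}
    (hv : K.IsOptimal L f C v)
    (hpos : (∃ I : Interp.{u} NC NI n, I.IsModel L f K) →
      ∃ I : Interp.{u} NC NI n, I.IsModel L f K ∧ ∃ x : I.Dom, 0 < I.deg L C x) :
    0 < C.value L (v .aux) := by
  obtain ⟨J, hJ, -⟩ := hv.isAdmissible.exists_isCanonical.{u} Set.finite_empty
  obtain ⟨I, hI, x, hx⟩ := hpos ⟨J, hJ.1⟩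
  exact (I.deg_eq_value C x ▸ hx).trans_le (hv.value_le _ (hI.isAdmissible x))

/-! ### Answer sets of the encoding -/

section AnswerSet

variable {β : Type*} {P : Set (GRule β)} {S M : Set β} {a : β} {B : Set β}

theorem reductClosed_self (h : ∀ r ∈ P, r.Sat S) : ReductClosed P S S := by
  rintro ⟨head, pos, neg⟩ hr hneg hpos
  have hsat := h _ hr hpos hneg
  cases head with
  | atom a => exact Set.singleton_subset_iff.2 hsat
  | falsum => exact hsat.elim
  | exactlyOne s => exact Set.inter_subset_right

theorem IsAnswerSet.subset (h : IsAnswerSet P S) (hM : ReductClosed P S M) : S ⊆ M :=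
  h.2 ▸ Set.sInter_subset_of_mem hM

theorem ReductClosed.mem_of_rule (hM : ReductClosed P S M) (hr : GRule.rule a B ∈ P)
    (hB : B ⊆ M) : a ∈ M :=
  hM _ hr (Set.empty_disjoint _) hB rfl

theorem ReductClosed.mem_of_fact (hM : ReductClosed P S M) (hr : GRule.fact a ∈ P) : a ∈ M :=
  hM.mem_of_rule hr (Set.empty_subset _)

theorem not_subset_of_constraint (h : ∀ r ∈ P, r.Sat S) (hr : GRule.constraint B ∈ P) : ¬ B ⊆ S :=
  fun hB => h _ hr hB (Set.empty_disjoint _)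

end AnswerSet

/-- The concepts `E` for which the program derives `concept(E)`: those of `K`, `C`, `D` and their
subconcepts. -/
inductive Relevant (K : KB NC NI) (C D : BConcept NC) : BConcept NC → Prop
  | base {E : BConcept NC} (hE : E ∈ K.concepts ∨ E = C ∨ E = D) : Relevant K C D E
  | andL {E F : BConcept NC} (h : Relevant K C D (.and E F)) : Relevant K C D E
  | andR {E F : BConcept NC} (h : Relevant K C D (.and E F)) : Relevant K C D F
  | orL {E F : BConcept NC} (h : Relevant K C D (.or E F)) : Relevant K C D E
  | orR {E F : BConcept NC} (h : Relevant K C D (.or E F)) : Relevant K C D F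
  | neg {E : BConcept NC} (h : Relevant K C D (.neg E)) : Relevant K C D E

/-- The concept names `A` with a fact `cls(A)`. -/
def KB.queryNames (K : KB NC NI) (C D : BConcept NC) : Set NC := K.names ∪ C.names ∪ D.names

namespace Relevant

variable {K : KB NC NI} {C D E : BConcept NC}

theorem left : Relevant K C D C := .base (Or.inr (Or.inl rfl))

theorem right : Relevant K C D D := .base (Or.inr (Or.inr rfl))

theorem names_subset (h : Relevant K C D E) : E.names ⊆ K.queryNames C D := by
  induction h with
  | base hE =>
    intro A hA
    rcases hE with hE | rfl | rfl
    · exact Or.inl (Or.inl ⟨_, hE, hA⟩)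
    · exact Or.inl (Or.inr hA)
    · exact Or.inr hA
  | andL _ ih | orL _ ih => exact fun A hA => ih (Or.inl hA)
  | andR _ ih | orR _ ih => exact fun A hA => ih (Or.inr hA)
  | neg _ ih => exact ih

theorem of_mem_names (h : Relevant K C D E) {A : NC} (hA : A ∈ E.names) :
    Relevant K C D (.name A) := by
  induction E with
  | name B => cases hA; exact h
  | top | bot => exact hA.elim
  | and E F ihE ihF => exact hA.elim (ihE h.andL) (ihF h.andR)
  | or E F ihE ihF => exact hA.elim (ihE h.orL) (ihF h.orR)
  | neg E ih => exact ih h.neg hA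

theorem name_iff {A : NC} : Relevant K C D (.name A) ↔ A ∈ K.queryNames C D := by
  refine ⟨fun h => h.names_subset rfl, ?_⟩
  rintro ((⟨E, hE, hA⟩ | hA) | hA)
  · exact (Relevant.base (Or.inl hE)).of_mem_names hA
  · exact left.of_mem_names hA
  · exact right.of_mem_names hA

theorem of_lhs {t : Incl NC} (ht : t ∈ K.tbox) : Relevant K C D t.lhs :=
  .base (Or.inl (Or.inl ⟨t, ht, Or.inl rfl⟩))

theorem of_rhs {t : Incl NC} (ht : t ∈ K.tbox) : Relevant K C D t.rhs :=
  .base (Or.inl (Or.inl ⟨t, ht, Or.inr rfl⟩))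

theorem of_abox {s : Assertion NC NI} (hs : s ∈ K.abox) : Relevant K C D s.conc :=
  .base (Or.inl (Or.inr (Or.inl ⟨s, hs, rfl⟩)))

theorem of_dist (hE : E ∈ K.dist) : Relevant K C D E :=
  .base (Or.inl (Or.inr (Or.inr (Or.inl hE))))

theorem of_typ (hE : E ∈ K.dist) {p : BConcept NC × ℝ} (hp : p ∈ K.typ E) : Relevant K C D p.1 :=
  .base (Or.inl (Or.inr (Or.inr (Or.inr ⟨E, hE, p, hp, rfl⟩))))

end Relevant

theorem KB.HasDecimalWeights.cast_weightInt {K : KB NC NI} (hK : K.HasDecimalWeights k)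
    {E : BConcept NC} (hE : E ∈ K.dist) {p : BConcept NC × ℝ} (hp : p ∈ K.typ E) :
    (weightInt k p.2 : ℝ) = p.2 * 10 ^ k := by
  obtain ⟨z, hz⟩ := hK E hE p hp
  rw [weightInt, hz, round_intCast]

theorem KB.HasDecimalWeights.cast_sum_weightInt_mul {K : KB NC NI} (hK : K.HasDecimalWeights k)
    {E : BConcept NC} (hE : E ∈ K.dist) {c : Assignment NC n} {V : BConcept NC × ℝ → ℤ}
    (hV : ∀ p ∈ K.typ E, (V p : ℝ) = p.1.value L c * n) :
    ((∑ p ∈ K.typ E, weightInt k p.2 * V p : ℤ) : ℝ) = K.weightedSum L c E * (n * 10 ^ k) := by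
  rw [weightedSum, Finset.sum_mul, Int.cast_sum]
  refine Finset.sum_congr rfl fun p hp => ?_
  rw [Int.cast_mul, hK.cast_weightInt hE hp, hV p hp]
  ring

theorem KB.HasDecimalWeights.exists_int_eq_weightedSum_mul [NeZero n] {K : KB NC NI}
    (hK : K.HasDecimalWeights k) (L : Family) {E : BConcept NC} (hE : E ∈ K.dist)
    (c : Assignment NC n) : ∃ W : ℤ, (W : ℝ) = K.weightedSum L c E * (n * 10 ^ k) := by
  choose V hV using fun p : BConcept NC × ℝ => p.1.exists_int_eq_value_mul L c
  exact ⟨_, hK.cast_sum_weightInt_mul hE fun p _ => hV p⟩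

section Encoding

variable {φ : ℝ → ℝ} {K : KB NC NI} {C D E F : BConcept NC} {θ : Cmp} {α : ℝ}
  {S M : Set (Atom NC NI)} {v v' : Const NI → Assignment NC n} {x : Const NI} {i j W : ℤ}

local notation "Prog" => encoding L φ n k K C D θ α

/-- The atoms in `S` among which the choice rules choose are those that describe `v`: `S` is the
outcome of guessing `v`. -/
def Guesses (K : KB NC NI) (C D : BConcept NC) (v : Const NI → Assignment NC n)
    (S : Set (Atom NC NI)) : Prop :=
  ∀ x, K.IsNom x → ∀ A ∈ K.queryNames C D, ∀ i : ℤ,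
    (0 ≤ i ∧ i ≤ n ∧ Atom.inst x A i ∈ S) ↔ (i : ℝ) = v x A * n

/-- The set of atoms that the program derives from the guess `v`. An integer `i` that stands for
`i / n` is compared with a value multiplied by `n`, a weighted sum also by `10 ^ k`. -/
def answerSet (L : Family) (φ : ℝ → ℝ) (k : ℕ) (K : KB NC NI) (C D : BConcept NC) (θ : Cmp) (α : ℝ)
    (v : Const NI → Assignment NC n) : Set (Atom NC NI) :=
  {a | match a with
    | .val i => 0 ≤ i ∧ i ≤ n
    | .nom x => K.IsNom x
    | .cls A => A ∈ K.queryNames C D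
    | .concept E => Relevant K C D E
    | .dcls E => E ∈ K.dist
    | .subTyp E F w => E ∈ K.dist ∧ ∃ p ∈ K.typ E, p.1 = F ∧ weightInt k p.2 = w
    | .inst x A i => K.IsNom x ∧ A ∈ K.queryNames C D ∧ (i : ℝ) = v x A * n
    | .eval E x i => K.IsNom x ∧ Relevant K C D E ∧ (i : ℝ) = E.value L (v x) * n
    | .weight x E W => K.IsNom x ∧ E ∈ K.dist ∧
        (W : ℝ) = K.weightedSum L (v x) E * (n * 10 ^ k)
    | .num W => ∃ x E, K.IsNom x ∧ E ∈ K.dist ∧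
        (W : ℝ) = K.weightedSum L (v x) E * (n * 10 ^ k)
    | .valphi W i => (∃ x E, K.IsNom x ∧ E ∈ K.dist ∧
        (W : ℝ) = K.weightedSum L (v x) E * (n * 10 ^ k)) ∧
        (i : ℝ) = phiN φ n (W / (n * 10 ^ k)) * n
    | .auxtc x E => x = .aux ∧ E = C
    | .ok => θ.Holds (D.value L (v .aux)) α
    | .notok => ¬ θ.Holds (D.value L (v .aux)) α}

local notation "Ans" => answerSet L φ k K C D θ α

theorem holds_mul_natCast_iff [NeZero n] {r : ℝ} (hi : (i : ℝ) = r * n) :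
    θ.Holds (i : ℝ) (α * n) ↔ θ.Holds r α := by
  rw [hi, θ.holds_mul_right_iff (Nat.cast_pos.2 (NeZero.pos n))]

theorem guesses_answerSet [NeZero n] : Guesses K C D v (Ans v) := by
  refine fun x hx A hA i => ⟨fun h => h.2.2.2.2, fun hi => ?_⟩
  obtain ⟨j, h0, hn, hj⟩ := mem_truthSpace_iff.1 (v x A).2
  obtain rfl : i = j := Int.cast_injective (hi.trans hj.symm)
  exact ⟨h0, hn, hx, hA, hi⟩

theorem exists_guesses [NeZero n] (hnom : ∀ x, K.IsNom x → Atom.nom x ∈ S)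
    (hcls : ∀ A ∈ K.queryNames C D, Atom.cls A ∈ S) (hS : ∀ r ∈ Prog, r.Sat S) :
    ∃ v : Const NI → Assignment NC n, Guesses K C D v S := by
  have hex : ∀ x, K.IsNom x → ∀ A ∈ K.queryNames C D, ∃ t : truthSpace n, ∀ i : ℤ,
      (0 ≤ i ∧ i ≤ n ∧ Atom.inst x A i ∈ S) ↔ (i : ℝ) = t * n := by
    intro x hx A hA
    obtain ⟨_, ⟨⟨i, h0, hn, rfl⟩, hi⟩, huniq⟩ := hS _ (EncRule.choice A x)
      (Set.pair_subset (hcls A hA) (hnom x hx)) (Set.empty_disjoint _)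
    have hin : (i : ℝ) = i / n * n := (div_mul_cancel₀ _ (NeZero.ne _)).symm
    refine ⟨⟨i / n, mem_truthSpace_iff.2 ⟨i, h0, hn, hin⟩⟩, fun j => ?_⟩
    rw [← hin, Int.cast_inj]
    constructor
    · rintro ⟨hj0, hjn, hj⟩
      cases huniq _ ⟨⟨j, hj0, hjn, rfl⟩, hj⟩
      rfl
    · rintro rfl
      exact ⟨h0, hn, hi⟩
  choose! v hv using hex
  exact ⟨v, hv⟩

namespace ReductClosed

variable (hM : ReductClosed (encoding L φ n k K C D θ α) S M)
include hM

theorem nom_mem (hx : K.IsNom x) : Atom.nom x ∈ M := by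
  cases x with
  | ind a => exact hM.mem_of_fact (EncRule.nom a hx)
  | aux => exact hM.mem_of_fact EncRule.nomAux

theorem cls_mem {A : NC} (hA : A ∈ K.queryNames C D) : Atom.cls A ∈ M :=
  hM.mem_of_fact (EncRule.cls A hA)

theorem concept_mem (hE : Relevant K C D E) : Atom.concept E ∈ M := by
  induction hE with
  | base hE => exact hM.mem_of_fact (EncRule.concept _ hE)
  | andL _ ih => exact hM.mem_of_rule (EncRule.conceptAndL _ _) (Set.singleton_subset_iff.2 ih)
  | andR _ ih => exact hM.mem_of_rule (EncRule.conceptAndR _ _) (Set.singleton_subset_iff.2 ih)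
  | orL _ ih => exact hM.mem_of_rule (EncRule.conceptOrL _ _) (Set.singleton_subset_iff.2 ih)
  | orR _ ih => exact hM.mem_of_rule (EncRule.conceptOrR _ _) (Set.singleton_subset_iff.2 ih)
  | neg _ ih => exact hM.mem_of_rule (EncRule.conceptNeg _) (Set.singleton_subset_iff.2 ih)

variable (hv : Guesses K C D v S) (hx : K.IsNom x)
include hv hx

theorem inst_mem {A : NC} (hA : A ∈ K.queryNames C D) (hi : (i : ℝ) = v x A * n) :
    Atom.inst x A i ∈ M := by
  obtain ⟨h0, hn, hiS⟩ := (hv x hx A hA i).2 hi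
  exact hM _ (EncRule.choice A x) (Set.empty_disjoint _)
    (Set.pair_subset (hM.cls_mem hA) (hM.nom_mem hx)) ⟨⟨i, h0, hn, rfl⟩, hiS⟩

variable [NeZero n]

theorem eval_mem (hE : Relevant K C D E) (hi : (i : ℝ) = E.value L (v x) * n) :
    Atom.eval E x i ∈ M := by
  suffices h : ∃ j : ℤ, (j : ℝ) = E.value L (v x) * n ∧ Atom.eval E x j ∈ M by
    obtain ⟨j, hj, hmem⟩ := h
    rwa [Int.cast_injective (hi.trans hj.symm)]
  clear hi
  induction E with
  | name A =>
    have hA := Relevant.name_iff.1 hE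
    obtain ⟨j, hj⟩ := BConcept.exists_int_eq_value_mul L (v x) (.name A)
    exact ⟨j, hj, hM.mem_of_rule (EncRule.evalName A x j)
      (Set.pair_subset (hM.cls_mem hA) (hM.inst_mem hv hx hA hj))⟩
  | top =>
    exact ⟨n, by simp [BConcept.value], hM.mem_of_rule (EncRule.evalTop x)
      (Set.pair_subset (hM.concept_mem hE) (hM.nom_mem hx))⟩
  | bot =>
    exact ⟨0, by simp [BConcept.value], hM.mem_of_rule (EncRule.evalBot x)
      (Set.pair_subset (hM.concept_mem hE) (hM.nom_mem hx))⟩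
  | and E F ihE ihF =>
    obtain ⟨i, hi, hiM⟩ := ihE hE.andL
    obtain ⟨j, hj, hjM⟩ := ihF hE.andR
    exact ⟨_, L.cast_tnormZ hi hj, hM.mem_of_rule (EncRule.evalAnd E F x i j)
      (Set.insert_subset (hM.concept_mem hE) (Set.pair_subset hiM hjM))⟩
  | or E F ihE ihF =>
    obtain ⟨i, hi, hiM⟩ := ihE hE.orL
    obtain ⟨j, hj, hjM⟩ := ihF hE.orR
    exact ⟨_, L.cast_snormZ hi hj, hM.mem_of_rule (EncRule.evalOr E F x i j)
      (Set.insert_subset (hM.concept_mem hE) (Set.pair_subset hiM hjM))⟩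
  | neg E ih =>
    obtain ⟨i, hi, hiM⟩ := ih hE.neg
    exact ⟨_, by push_cast [hi, BConcept.value]; ring, hM.mem_of_rule (EncRule.evalNeg E x i)
      (Set.pair_subset (hM.concept_mem hE) hiM)⟩

theorem weight_mem (hK : K.HasDecimalWeights k) (hE : E ∈ K.dist)
    (hW : (W : ℝ) = K.weightedSum L (v x) E * (n * 10 ^ k)) : Atom.weight x E W ∈ M := by
  choose V hV using fun p : BConcept NC × ℝ => p.1.exists_int_eq_value_mul L (v x)
  obtain rfl : W = ∑ p ∈ K.typ E, weightInt k p.2 * V p :=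
    Int.cast_injective (hW.trans (hK.cast_sum_weightInt_mul hE fun p _ => hV p).symm)
  refine hM.mem_of_rule (EncRule.weight E hE x V) ?_
  rintro a (rfl | ⟨p, hp, rfl | rfl⟩)
  · exact hM.nom_mem hx
  · exact hM.mem_of_fact (EncRule.subTyp E hE p hp)
  · exact hM.eval_mem hv hx (.of_typ hE hp) (hV p)

theorem num_mem (hK : K.HasDecimalWeights k) (hE : E ∈ K.dist)
    (hW : (W : ℝ) = K.weightedSum L (v x) E * (n * 10 ^ k)) : Atom.num W ∈ M :=
  hM.mem_of_rule (EncRule.num x E W) (Set.insert_subset (hM.nom_mem hx)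
    (Set.pair_subset (hM.weight_mem hv hx hK hE hW) (hM.mem_of_fact (EncRule.dcls E hE))))

omit hx in
theorem ok_mem (h : θ.Holds (D.value L (v .aux)) α) : Atom.ok ∈ M := by
  obtain ⟨i, hi⟩ := D.exists_int_eq_value_mul L (v .aux)
  exact hM.mem_of_rule (EncRule.ok i ((holds_mul_natCast_iff hi).2 h))
    (Set.singleton_subset_iff.2 (hM.eval_mem hv trivial .right hi))

omit hx in
theorem answerSet_subset (hK : K.HasDecimalWeights k)
    (hok : Atom.ok ∈ S → θ.Holds (D.value L (v .aux)) α) : Ans v ⊆ M := by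
  intro a ha
  cases a with
  | val i => exact hM.mem_of_fact (EncRule.val i ha.1 ha.2)
  | nom x => exact hM.nom_mem ha
  | cls A => exact hM.cls_mem ha
  | concept E => exact hM.concept_mem ha
  | dcls E => exact hM.mem_of_fact (EncRule.dcls E ha)
  | subTyp E F w =>
    obtain ⟨hE, p, hp, rfl, rfl⟩ := ha
    exact hM.mem_of_fact (EncRule.subTyp E hE p hp)
  | inst x A i => exact hM.inst_mem hv ha.1 ha.2.1 ha.2.2
  | eval E x i => exact hM.eval_mem hv ha.1 ha.2.1 ha.2.2
  | weight x E W => exact hM.weight_mem hv ha.1 hK ha.2.1 ha.2.2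
  | num W =>
    obtain ⟨x, E, hx, hE, hW⟩ := ha
    exact hM.num_mem hv hx hK hE hW
  | valphi W i =>
    obtain ⟨⟨x, E, hx, hE, hW⟩, hi⟩ := ha
    exact hM.mem_of_rule (EncRule.valphi W i (hi.trans (mul_comm _ _)))
      (Set.singleton_subset_iff.2 (hM.num_mem hv hx hK hE hW))
  | auxtc x E =>
    obtain ⟨rfl, rfl⟩ := ha
    exact hM.mem_of_fact EncRule.auxtc
  | ok => exact hM.ok_mem hv ha
  | notok =>
    exact hM _ EncRule.notok (Set.disjoint_singleton_left.2 fun h => ha (hok h))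
      (Set.empty_subset _) rfl

end ReductClosed

theorem eval_and_mem_answerSet (hEF : Relevant K C D (.and E F)) (hi : Atom.eval E x i ∈ Ans v)
    (hj : Atom.eval F x j ∈ Ans v) : Atom.eval (.and E F) x (L.tnormZ n i j) ∈ Ans v :=
  ⟨hi.1, hEF, L.cast_tnormZ hi.2.2 hj.2.2⟩

theorem eval_or_mem_answerSet (hEF : Relevant K C D (.or E F)) (hi : Atom.eval E x i ∈ Ans v)
    (hj : Atom.eval F x j ∈ Ans v) : Atom.eval (.or E F) x (L.snormZ n i j) ∈ Ans v :=
  ⟨hi.1, hEF, L.cast_snormZ hi.2.2 hj.2.2⟩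

theorem eval_neg_mem_answerSet (hE : Relevant K C D (.neg E)) (hi : Atom.eval E x i ∈ Ans v) :
    Atom.eval (.neg E) x (n - i) ∈ Ans v :=
  ⟨hi.1, hE, by push_cast [hi.2.2, BConcept.value]; ring⟩

theorem weight_mem_answerSet (hK : K.HasDecimalWeights k) (hx : K.IsNom x) (hE : E ∈ K.dist)
    {V : BConcept NC × ℝ → ℤ} (hV : ∀ p ∈ K.typ E, Atom.eval p.1 x (V p) ∈ Ans v) :
    Atom.weight x E (∑ p ∈ K.typ E, weightInt k p.2 * V p) ∈ Ans v :=
  ⟨hx, hE, hK.cast_sum_weightInt_mul hE fun p hp => (hV p hp).2.2⟩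

theorem reductClosed_answerSet [NeZero n] (hK : K.HasDecimalWeights k) (hv : Guesses K C D v S)
    (hok : θ.Holds (D.value L (v .aux)) α → Atom.ok ∈ S) : ReductClosed Prog S (Ans v) := by
  intro r hr hneg hpos
  have mem : ∀ a ∈ r.pos, a ∈ Ans v := fun a h => hpos h
  have single : ∀ a, a ∈ Ans v → {a} ⊆ Ans v := fun a => Set.singleton_subset_iff.2
  cases hr with
  | val i h0 hn => exact single _ ⟨h0, hn⟩
  | nom a ha => exact single _ ha
  | nomAux => exact single _ trivial
  | auxtc => exact single _ ⟨rfl, rfl⟩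
  | cls A hA => exact single _ hA
  | dcls E hE => exact single _ hE
  | subTyp E hE p hp => exact single _ ⟨hE, p, hp, rfl, rfl⟩
  | concept E hE => exact single _ (.base hE)
  | conceptAndL E F => exact single _ (.andL (mem _ rfl))
  | conceptAndR E F => exact single _ (.andR (mem _ rfl))
  | conceptOrL E F => exact single _ (.orL (mem _ rfl))
  | conceptOrR E F => exact single _ (.orR (mem _ rfl))
  | conceptNeg E => exact single _ (.neg (mem _ rfl))
  | choice A x =>
    obtain ⟨hA, hx⟩ := Set.pair_subset_iff.1 hpos
    rintro _ ⟨⟨i, h0, hn, rfl⟩, hi⟩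
    exact ⟨hx, hA, (hv x hx A hA i).1 ⟨h0, hn, hi⟩⟩
  | evalName A x i =>
    obtain ⟨hx, hA, hi⟩ := mem _ (.inr rfl)
    exact single _ ⟨hx, Relevant.name_iff.2 hA, hi⟩
  | evalTop x => exact single _ ⟨mem _ (.inr rfl), mem _ (.inl rfl), (one_mul _).symm⟩
  | evalBot x => exact single _ ⟨mem _ (.inr rfl), mem _ (.inl rfl), by simp [BConcept.value]⟩
  | evalAnd E F x i j => exact single _ (eval_and_mem_answerSet (mem _ (.inl rfl))
      (mem _ (.inr (.inl rfl))) (mem _ (.inr (.inr rfl))))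
  | evalOr E F x i j => exact single _ (eval_or_mem_answerSet (mem _ (.inl rfl))
      (mem _ (.inr (.inl rfl))) (mem _ (.inr (.inr rfl))))
  | evalNeg E x i => exact single _ (eval_neg_mem_answerSet (mem _ (.inl rfl)) (mem _ (.inr rfl)))
  | abox | tbox | coherence => exact Set.empty_subset _
  | weight E hE x V => exact single _ (weight_mem_answerSet hK (mem _ (.inl rfl)) hE
      fun p hp => mem _ (.inr ⟨p, hp, .inr rfl⟩))
  | num x E W => exact single _ ⟨x, E, mem _ (.inr (.inl rfl))⟩
  | valphi W i h => exact single _ ⟨mem _ rfl, h.trans (mul_comm _ _)⟩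
  | ok i h => exact single _ ((holds_mul_natCast_iff (mem _ rfl).2.2).1 h)
  | notok => exact single _ fun h => Set.disjoint_singleton_left.1 hneg (hok h)

theorem IsAnswerSet.answerSet_eq [NeZero n] (hK : K.HasDecimalWeights k) (hS : IsAnswerSet Prog S)
    (hv : Guesses K C D v S) : Ans v = S := by
  have hclosed := reductClosed_self hS.1
  have hsub := hS.subset (reductClosed_answerSet hK hv (hclosed.ok_mem hv))
  exact (hclosed.answerSet_subset hv hK fun h => hsub h).antisymm hsub

theorem natCast_mul_ten_pow_ne_zero [NeZero n] (k : ℕ) : (n : ℝ) * 10 ^ k ≠ 0 :=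
  mul_ne_zero (NeZero.ne _) (by positivity)

theorem KB.IsAdmissible.of_sat_answerSet [NeZero n] (hK : K.HasDecimalWeights k)
    (h : ∀ r ∈ Prog, r.Sat (Ans v)) : K.IsAdmissible L (phiN φ n) v := by
  refine ⟨fun x hx => ⟨fun t ht => ?incl, fun E hE => ?coherent⟩, fun s hs => ?assertion⟩
  case incl =>
    obtain ⟨i, hi⟩ := t.lhs.exists_int_eq_value_mul L (v x)
    obtain ⟨j, hj⟩ := t.rhs.exists_int_eq_value_mul L (v x)
    rw [← holds_mul_natCast_iff (L.cast_implZ hi hj)]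
    by_contra hcon
    exact not_subset_of_constraint h (EncRule.tbox t ht x i j hcon)
      (Set.pair_subset ⟨hx, .of_lhs ht, hi⟩ ⟨hx, .of_rhs ht, hj⟩)
  case coherent =>
    obtain ⟨i, hi⟩ := E.exists_int_eq_value_mul L (v x)
    obtain ⟨W, hW⟩ := hK.exists_int_eq_weightedSum_mul L hE (v x)
    obtain ⟨j, hj⟩ := exists_int_eq_phiN_mul (n := n) φ (K.weightedSum L (v x) E)
    by_contra hne
    have hij : i ≠ j := by
      rintro rfl
      exact hne (mul_right_cancel₀ (NeZero.ne (n : ℝ)) (hi.symm.trans hj))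
    rw [← (div_eq_iff (natCast_mul_ten_pow_ne_zero k)).2 hW] at hj
    refine not_subset_of_constraint h (EncRule.coherence x E i j W hij) ?_
    rintro a (rfl | rfl | rfl | rfl | rfl)
    exacts [hx, hE, ⟨hx, .of_dist hE, hi⟩, ⟨hx, hE, hW⟩, ⟨⟨x, E, hx, hE, hW⟩, hj⟩]
  case assertion =>
    obtain ⟨i, hi⟩ := s.conc.exists_int_eq_value_mul L (v (.ind s.ind))
    rw [← holds_mul_natCast_iff hi]
    by_contra hcon
    exact not_subset_of_constraint h (EncRule.abox s hs i hcon)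
      (Set.singleton_subset_iff.2 ⟨⟨s, hs, rfl⟩, .of_abox hs, hi⟩)

theorem KB.IsAdmissible.sat_answerSet [NeZero n] (hK : K.HasDecimalWeights k)
    (hv : K.IsAdmissible L (phiN φ n) v) : ∀ r ∈ Prog, r.Sat (Ans v) := by
  intro r hr hpos hneg
  have hhead := reductClosed_answerSet hK guesses_answerSet id r hr hneg hpos
  cases hr with
  | choice A x =>
    obtain ⟨hA, hx⟩ := Set.pair_subset_iff.1 hpos
    obtain ⟨i, h0, hn, hi⟩ := mem_truthSpace_iff.1 (v x A).2
    refine ⟨.inst x A i, ⟨⟨i, h0, hn, rfl⟩, hx, hA, hi⟩, ?_⟩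
    rintro _ ⟨⟨j, -, -, rfl⟩, -, -, hj⟩
    rw [Int.cast_injective (hj.trans hi.symm)]
  | abox s hs i h =>
    obtain ⟨-, -, hi⟩ := Set.singleton_subset_iff.1 hpos
    exact h ((holds_mul_natCast_iff hi).2 (hv.assertion s hs))
  | tbox t ht x i j h =>
    obtain ⟨⟨hx, -, hi⟩, -, -, hj⟩ := Set.pair_subset_iff.1 hpos
    exact h ((holds_mul_natCast_iff (L.cast_implZ hi hj)).2 ((hv.admits x hx).incl t ht))
  | coherence x E i j W h =>
    simp only [GRule.constraint, Set.insert_subset_iff, Set.singleton_subset_iff] at hpos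
    obtain ⟨hx, hE, ⟨-, -, hi⟩, ⟨-, -, hW⟩, -, hj⟩ := hpos
    rw [(div_eq_iff (natCast_mul_ten_pow_ne_zero k)).2 hW,
      ← (hv.admits x hx).coherent E hE] at hj
    exact h (Int.cast_injective (hi.trans hj.symm))
  | _ => exact hhead rfl

theorem isAnswerSet_encoding_iff [NeZero n] (hK : K.HasDecimalWeights k) :
    IsAnswerSet Prog S ↔
      ∃ v : Const NI → Assignment NC n, K.IsAdmissible L (phiN φ n) v ∧ Ans v = S := by
  constructor
  · intro hS
    have hclosed := reductClosed_self hS.1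
    obtain ⟨v, hv⟩ := exists_guesses (fun x => hclosed.nom_mem) (fun A => hclosed.cls_mem) hS.1
    obtain rfl := hS.answerSet_eq hK hv
    exact ⟨v, .of_sat_answerSet hK hS.1, rfl⟩
  · rintro ⟨v, hv, rfl⟩
    have hsat : ∀ r ∈ Prog, r.Sat (Ans v) := hv.sat_answerSet hK
    refine ⟨hsat, (Set.subset_sInter fun M hM => ?_).antisymm
      (Set.sInter_subset_of_mem (reductClosed_self hsat))⟩
    exact hM.answerSet_subset guesses_answerSet hK id

/-! ### Preferred answer sets -/

theorem better_answerSet_iff [NeZero n] :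
    Better (Ans v') (Ans v) ↔ C.value L (v .aux) < C.value L (v' .aux) := by
  have hn : (0 : ℝ) < n := Nat.cast_pos.2 (NeZero.pos n)
  constructor
  · rintro ⟨_, ⟨-, rfl⟩, i, j, ⟨-, -, hi⟩, ⟨-, -, hj⟩, hij⟩
    rwa [gt_iff_lt, ← Int.cast_lt (R := ℝ), hi, hj, mul_lt_mul_iff_left₀ hn] at hij
  · intro hlt
    obtain ⟨i, hi⟩ := C.exists_int_eq_value_mul L (v' .aux)
    obtain ⟨j, hj⟩ := C.exists_int_eq_value_mul L (v .aux)
    refine ⟨C, ⟨rfl, rfl⟩, i, j, ⟨trivial, .left, hi⟩, ⟨trivial, .left, hj⟩, ?_⟩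
    rwa [gt_iff_lt, ← Int.cast_lt (R := ℝ), hi, hj, mul_lt_mul_iff_left₀ hn]

theorem isPreferred_encoding_iff [NeZero n] (hK : K.HasDecimalWeights k) :
    IsPreferred Prog S ↔
      ∃ v : Const NI → Assignment NC n, K.IsOptimal L (phiN φ n) C v ∧ Ans v = S := by
  simp only [IsPreferred, isAnswerSet_encoding_iff hK]
  constructor
  · rintro ⟨⟨v, hv, rfl⟩, hbest⟩
    refine ⟨v, ⟨hv, fun v' hv' => not_lt.1 fun hlt => hbest ?_⟩, rfl⟩
    exact ⟨_, ⟨v', hv', rfl⟩, better_answerSet_iff.2 hlt⟩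
  · rintro ⟨v, hv, rfl⟩
    refine ⟨⟨v, hv.isAdmissible, rfl⟩, ?_⟩
    rintro ⟨_, ⟨v', hv', rfl⟩, hbetter⟩
    exact (hv.value_le v' hv').not_gt (better_answerSet_iff.1 hbetter)

theorem exists_eval_mem_answerSet_not_holds_iff [NeZero n] :
    (∃ i : ℤ, Atom.eval D .aux i ∈ Ans v ∧ ¬ θ.Holds (i : ℝ) (α * n)) ↔
      ¬ θ.Holds (D.value L (v .aux)) α := by
  constructor
  · rintro ⟨i, ⟨-, -, hi⟩, h⟩
    rwa [holds_mul_natCast_iff hi] at h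
  · intro h
    obtain ⟨i, hi⟩ := D.exists_int_eq_value_mul L (v .aux)
    exact ⟨i, ⟨trivial, .right, hi⟩, (holds_mul_natCast_iff hi).not.2 h⟩

end Encoding

end MVDL

open MVDL in
theorem proposition2_general {NC : Type v} {NI : Type w} (L : Family) (φ : ℝ → ℝ) (n : ℕ)
    (hn : 1 ≤ n) (k : ℕ) (K : KB NC NI) (hK : K.HasDecimalWeights k) (C D : BConcept NC)
    (θ : Cmp) (α : ℝ) (hC : C.names ⊆ K.names)
    (hpos : (∃ I : Interp.{u} NC NI n, I.IsModel L (phiN φ n) K) →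
      ∃ I : Interp.{u} NC NI n, I.IsModel L (phiN φ n) K ∧ ∃ x : I.Dom, 0 < I.deg L C x) :
    ((∃ I : Interp.{u} NC NI n,
        I.IsCanonical L (phiN φ n) K ∧ ¬ I.SatTypIncl L C D θ α) ↔
      ∃ S : Set (Atom NC NI), IsPreferred (encoding L φ n k K C D θ α) S ∧
        ∃ i : ℤ, Atom.eval D .aux i ∈ S ∧ ¬ θ.Holds (i : ℝ) (α * n)) ∧
    (∀ S : Set (Atom NC NI), IsPreferred (encoding L φ n k K C D θ α) S →
      (∃ i : ℤ, Atom.eval D .aux i ∈ S ∧ ¬ θ.Holds (i : ℝ) (α * n)) → Atom.notok ∈ S) := by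
  have : NeZero n := ⟨Nat.one_le_iff_ne_zero.1 hn⟩
  simp only [exists_isCanonical_not_satTypIncl_iff hC, isPreferred_encoding_iff hK]
  refine ⟨⟨?_, ?_⟩, ?_⟩
  · rintro ⟨v, hv, -, hD⟩
    exact ⟨_, ⟨v, hv, rfl⟩, exists_eval_mem_answerSet_not_holds_iff.2 hD⟩
  · rintro ⟨_, ⟨v, hv, rfl⟩, hD⟩
    exact ⟨v, hv, hv.value_pos hpos, exists_eval_mem_answerSet_not_holds_iff.1 hD⟩
  · rintro _ ⟨v, -, rfl⟩ hD
    exact exists_eval_mem_answerSet_not_holds_iff.1 hD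

theorem proposition2 {NC : Type v} {NI : Type w} (L : MVDL.Family)
    (φ : ℝ → ℝ) (hφ : ∀ x, φ x ∈ Set.Icc (0 : ℝ) 1) (hmono : Monotone φ)
    (n : ℕ) (hn : 1 ≤ n) (k : ℕ)
    (K : MVDL.KB NC NI) (hK : K.HasDecimalWeights k)
    (C D : MVDL.BConcept NC) (θ : MVDL.Cmp) (α : ℝ) (hα : α ∈ Set.Icc (0 : ℝ) 1)
    (hC : C.names ⊆ K.names)
    (hpos : (∃ I : MVDL.Interp.{u} NC NI n, I.IsModel L (MVDL.phiN φ n) K) →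
      ∃ I : MVDL.Interp.{u} NC NI n, I.IsModel L (MVDL.phiN φ n) K ∧
        ∃ x : I.Dom, 0 < I.deg L C x) :
    ((∃ I : MVDL.Interp.{u} NC NI n,
        I.IsCanonical L (MVDL.phiN φ n) K ∧ ¬ I.SatTypIncl L C D θ α) ↔
      ∃ S : Set (MVDL.Atom NC NI),
        MVDL.IsPreferred (MVDL.encoding L φ n k K C D θ α) S ∧
          ∃ i : ℤ, MVDL.Atom.eval D .aux i ∈ S ∧ ¬ θ.Holds (i : ℝ) (α * n)) ∧
    (∀ S : Set (MVDL.Atom NC NI),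
      MVDL.IsPreferred (MVDL.encoding L φ n k K C D θ α) S →
        (∃ i : ℤ, MVDL.Atom.eval D .aux i ∈ S ∧ ¬ θ.Holds (i : ℝ) (α * n)) →
          MVDL.Atom.notok ∈ S) :=
  proposition2_general L φ n hn k K hK C D θ α hC hpos
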